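/- Let $\lambda_0,\lambda,\alpha,\beta>0$ with $\alpha<\beta$, and let $(N_t)_{t\ge 0}$ be an exponentially decaying Hawkes process with these parameters: a counting process ($N_0=0$, integer-valued, right-continuous, increasing only in jumps of size $1$) with arrival times $0<T_1<T_2<\cdots$ whose conditional intensity with respect to its own history is $$\lambda^*_t=\lambda+(\lambda_0-\lambda)e^{-\beta t}+\sum_{T_i<t}\alpha e^{-\beta(t-T_i)},\qquad t\ge 0,$$ that is, $N_t-\int_0^t\lambda^*_s\,\mathrm ds$ is a local martingale with respect to the filtration generated by $N$. Let $\tau\ge 0$. Then $N_{t+\tau}-N_t$ is integrable for every $t\ge0$, and $$\lim_{t\to\infty}\mathbb E\left[N_{t+\tau}-N_t\,\middle|\,\lambda_0\right]=\frac{\lambda\beta}{\beta-\alpha}\,\tau ,$$ where $\mathbb E[\,\cdot\mid\lambda_0]$ denotes expectation for the process started with the deterministic initial intensity $\lambda_0$. -/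

import Mathlib

open MeasureTheory ProbabilityTheory Filter Topology
open scoped NNReal

namespace Hawkes

variable {Ω : Type*} [mΩ : MeasurableSpace Ω]

/-- A counting process `(N t)`, `t ≥ 0`: an `ℕ`-valued stochastic process with `N 0 = 0` whose
sample paths are non-decreasing, right-continuous, and increase only in jumps of size one.
(Being `ℕ`-valued, it has finitely many arrivals in every bounded time interval.) -/
structure IsCountingProcess (N : ℝ≥0 → Ω → ℕ) : Prop where
  measurable : ∀ t, Measurable (N t)
  zero : ∀ ω, N 0 ω = 0
  mono : ∀ ω, Monotone fun t => N t ω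
  right_cts : ∀ ω t, ContinuousWithinAt (fun s => N s ω) (Set.Ici t) t
  jump_le_one : ∀ ω t, ∀ᶠ s in 𝓝[<] t, N t ω ≤ N s ω + 1

/-- The history of the process: the filtration generated by `N`. -/
noncomputable def history (N : ℝ≥0 → Ω → ℕ) (hN : ∀ t, Measurable (N t)) :
    Filtration ℝ≥0 mΩ :=
  Filtration.natural N fun t => (hN t).stronglyMeasurable

/-- The `i`-th arrival time `T_i = inf {t | i ≤ N t}`. It is meaningful on the event that there is
an `i`-th arrival, i.e. that `i ≤ N t` for some `t`; it is used on this event only. -/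
noncomputable def arrivalTime (N : ℝ≥0 → Ω → ℕ) (i : ℕ) (ω : Ω) : ℝ≥0 :=
  sInf {t | i ≤ N t ω}

/-- The exponentially decaying intensity
`λ + (λ₀ - λ) exp (-β t) + ∑_{T_i < t} α exp (-β (t - T_i))`.
The arrivals up to time `t` are those with index `1 ≤ i ≤ N t`. As a process it is adapted and
left-continuous, hence predictable. -/
noncomputable def expIntensity (lam₀ lam α β : ℝ) (N : ℝ≥0 → Ω → ℕ) (t : ℝ≥0) (ω : Ω) : ℝ :=
  lam + (lam₀ - lam) * Real.exp (-β * t) +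
    ∑ i ∈ (Finset.Icc 1 (N t ω)).filter (fun i => arrivalTime N i ω < t),
      α * Real.exp (-β * ((t : ℝ) - arrivalTime N i ω))

/-- The integrated intensity `Λ t = ∫_0^t ℓ_s ds` of an intensity process `ℓ`. -/
noncomputable def compensator (ℓ : ℝ≥0 → Ω → ℝ) (t : ℝ≥0) (ω : Ω) : ℝ :=
  ∫ s in (0 : ℝ)..t, ℓ s.toNNReal ω

/-- `M` is a local martingale: there are stopping times `τ n ↑ ∞` almost surely such that every
stopped process `M^{τ n} 1_{τ n > 0}` is a martingale. -/
def IsLocalMartingale (M : ℝ≥0 → Ω → ℝ)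
    (𝓕 : Filtration ℝ≥0 mΩ) (P : Measure Ω) : Prop :=
  Locally (fun X => Martingale X 𝓕 P) 𝓕 M P

/-- `N` is an exponentially decaying Hawkes process with initial intensity `lam₀`, background rate
`lam`, and excitation function `α exp (-β t)`: a counting process whose conditional intensity with
respect to its own history is `expIntensity`, i.e. `N - ∫ expIntensity` is a local martingale. -/
structure IsExpHawkesProcess (lam₀ lam α β : ℝ) (N : ℝ≥0 → Ω → ℕ) (P : Measure Ω) : Prop where
  counting : IsCountingProcess N
  intensity : IsLocalMartingale
    (fun t ω => (N t ω : ℝ) - compensator (expIntensity lam₀ lam α β N) t ω)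
    (history N counting.measurable) P

end Hawkes

/-! ### The compensator as a convolution of the path. -/

namespace Hawkes

/-! Integrating the intensity arrival by arrival turns the compensator into an explicit function of
`t` plus `α` times the convolution of `exp (-β ·)` with the path of `N`
(`compensator_expIntensity`). If `N` minus its compensator has mean zero, then Fubini gives a linear
Volterra equation for the mean of `N`. Its solution is a linear term of slope `lam * β / (β - α)`
plus a multiple of `1 - exp (-(β - α) t)`, whose increments over a window of length `τ` vanish as `t
→ ∞`.

Only a local martingale is given, so mean zero must be earned. The kernel has mass at most `1 / β`,
hence the compensator is at most `C + (α / β) N`. Since `α < β`, the local martingale is bounded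
below by `(1 - α / β) N - C`: Fatou along a localizing sequence gives integrability of `N t`, and
then `C + N t` dominates the local martingale up to time `t`, so dominated convergence gives mean
zero. -/

theorem intervalIntegral_ite_lt {a t : ℝ} (f : ℝ → ℝ) (ha : 0 ≤ a) (hat : a ≤ t) :
    ∫ s in (0 : ℝ)..t, (if a < s then f s else 0) = ∫ s in a..t, f s := by
  rw [intervalIntegral.integral_of_le (ha.trans hat), intervalIntegral.integral_of_le hat]
  have : (fun s => if a < s then f s else 0) = (Set.Ioi a).indicator f := by
    ext s; simp [Set.indicator_apply]
  rw [this, setIntegral_indicator measurableSet_Ioi]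
  congr 2
  ext s
  simp only [Set.mem_inter_iff, Set.mem_Ioc, Set.mem_Ioi]
  constructor
  · rintro ⟨⟨_, h⟩, h'⟩; exact ⟨h', h⟩
  · rintro ⟨h, h'⟩; exact ⟨⟨ha.trans_lt h, h'⟩, h⟩

theorem intervalIntegrable_ite_lt {a t : ℝ} {f : ℝ → ℝ} (hf : Continuous f) :
    IntervalIntegrable (fun s => if a < s then f s else 0) volume 0 t := by
  have : (fun s => if a < s then f s else 0) = (Set.Ioi a).indicator f := by
    ext s; simp [Set.indicator_apply]
  rw [this, intervalIntegrable_iff]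
  exact (intervalIntegrable_iff.1 (hf.intervalIntegrable 0 t)).indicator measurableSet_Ioi

theorem integral_exp_neg_sub_eq (β a t : ℝ) :
    ∫ s in a..t, Real.exp (-β * (s - a)) = ∫ s in a..t, Real.exp (-β * (t - s)) := by
  have h := intervalIntegral.integral_comp_sub_left (a := a) (b := t)
    (fun s => Real.exp (-β * (s - a))) (a + t)
  simp only [add_sub_cancel_right, add_sub_cancel_left] at h
  rw [← h]
  congr 1
  ext s
  congr 2
  ring

theorem integral_exp_neg_mul {β : ℝ} (hβ : β ≠ 0) (t : ℝ) :
    ∫ s in (0 : ℝ)..t, Real.exp (-β * s) = (1 - Real.exp (-β * t)) / β := by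
  rw [intervalIntegral.integral_comp_mul_left (f := Real.exp) (neg_ne_zero.2 hβ), integral_exp]
  simp
  field_simp
  ring

variable {Ω : Type*} {N : ℝ≥0 → Ω → ℕ}

theorem arrivalTime_le {t : ℝ≥0} {ω : Ω} {i : ℕ} (h : i ≤ N t ω) :
    arrivalTime N i ω ≤ t :=
  csInf_le' h

variable [MeasurableSpace Ω]

theorem IsCountingProcess.le_of_arrivalTime_lt (hN : IsCountingProcess N) {s t : ℝ≥0} {ω : Ω}
    {i : ℕ} (hi : i ≤ N t ω) (h : arrivalTime N i ω < s) : i ≤ N s ω := by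
  obtain ⟨r, hr, hrs⟩ := exists_lt_of_csInf_lt (s := {t | i ≤ N t ω}) ⟨t, hi⟩ h
  exact le_trans hr (hN.mono ω hrs.le)

/-- Makes the index set independent of `s`, so that the sum can be exchanged with the integral over
`s`; the indicator removes the arrivals at or after `s`. -/
theorem IsCountingProcess.expIntensity_eq (hN : IsCountingProcess N) (lam₀ lam α β : ℝ)
    {s t : ℝ≥0} (hst : s ≤ t) (ω : Ω) :
    expIntensity lam₀ lam α β N s ω = lam + (lam₀ - lam) * Real.exp (-β * s) +
      ∑ i ∈ Finset.Icc 1 (N t ω), if (arrivalTime N i ω : ℝ) < s then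
        α * Real.exp (-β * ((s : ℝ) - arrivalTime N i ω)) else 0 := by
  rw [expIntensity, ← Finset.sum_filter]
  congr 2
  ext i
  simp only [Finset.mem_filter, Finset.mem_Icc, NNReal.coe_lt_coe]
  constructor
  · rintro ⟨⟨h1, h2⟩, h3⟩
    exact ⟨⟨h1, h2.trans (hN.mono ω hst)⟩, h3⟩
  · rintro ⟨⟨h1, h2⟩, h3⟩
    exact ⟨⟨h1, hN.le_of_arrivalTime_lt h2 h3⟩, h3⟩

/-- Arrival times must be excluded: by right-continuity `N` already counts an arrival occurring at
`s`, whereas the strict inequality does not. -/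
theorem IsCountingProcess.count_eq_sum (hN : IsCountingProcess N) {s t : ℝ≥0} (hst : s ≤ t)
    {ω : Ω} (hs : ∀ i ∈ Finset.Icc 1 (N t ω), arrivalTime N i ω ≠ s) :
    (N s ω : ℝ) = ∑ i ∈ Finset.Icc 1 (N t ω), if (arrivalTime N i ω : ℝ) < s then 1 else 0 := by
  rw [← Finset.sum_filter, Finset.sum_const, nsmul_one, Nat.cast_inj]
  have : (Finset.Icc 1 (N t ω)).filter (fun i => (arrivalTime N i ω : ℝ) < s)
      = Finset.Icc 1 (N s ω) := by
    ext i
    simp only [Finset.mem_filter, Finset.mem_Icc, NNReal.coe_lt_coe]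
    constructor
    · rintro ⟨⟨h1, h2⟩, h3⟩
      exact ⟨h1, hN.le_of_arrivalTime_lt h2 h3⟩
    · rintro ⟨h1, h2⟩
      have h3 := h2.trans (hN.mono ω hst)
      exact ⟨⟨h1, h3⟩, lt_of_le_of_ne (arrivalTime_le h2) (hs i (Finset.mem_Icc.2 ⟨h1, h3⟩))⟩
  rw [this]
  simp

/-- The compensator of the exponential intensity is a convolution of the path of `N`. -/
theorem IsCountingProcess.compensator_expIntensity (hN : IsCountingProcess N)
    (lam₀ lam α : ℝ) {β : ℝ} (hβ : β ≠ 0) (t : ℝ≥0) (ω : Ω) :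
    compensator (expIntensity lam₀ lam α β N) t ω =
      lam * t + (lam₀ - lam) / β * (1 - Real.exp (-β * t)) +
        α * ∫ s in (0 : ℝ)..t, Real.exp (-β * (t - s)) * N s.toNNReal ω := by
  have hT : ∀ i ∈ Finset.Icc 1 (N t ω), arrivalTime N i ω ≤ t := fun i hi =>
    arrivalTime_le (Finset.mem_Icc.1 hi).2
  have h1 : compensator (expIntensity lam₀ lam α β N) t ω =
      ∫ s in (0 : ℝ)..t, (lam + (lam₀ - lam) * Real.exp (-β * s) +
        ∑ i ∈ Finset.Icc 1 (N t ω), if (arrivalTime N i ω : ℝ) < s then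
          α * Real.exp (-β * (s - arrivalTime N i ω)) else 0) := by
    refine intervalIntegral.integral_congr fun s hs => ?_
    rw [Set.uIcc_of_le t.coe_nonneg] at hs
    rw [hN.expIntensity_eq lam₀ lam α β (t := t) (Real.toNNReal_le_iff_le_coe.2 hs.2),
      Real.coe_toNNReal s hs.1]
  have h2 : ∫ s in (0 : ℝ)..t, Real.exp (-β * (t - s)) * N s.toNNReal ω =
      ∫ s in (0 : ℝ)..t, ∑ i ∈ Finset.Icc 1 (N t ω), if (arrivalTime N i ω : ℝ) < s then
        Real.exp (-β * (t - s)) else 0 := by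
    -- The two integrands may differ only at the finitely many arrival times, a null set.
    refine intervalIntegral.integral_congr_ae ?_
    have hfin : ((Finset.Icc 1 (N t ω)).image
        (fun i => (arrivalTime N i ω : ℝ)) : Set ℝ).Finite := Finset.finite_toSet _
    filter_upwards [compl_mem_ae_iff.2 (hfin.measure_zero volume)] with s hs hst
    rw [Set.uIoc_of_le t.coe_nonneg] at hst
    rw [hN.count_eq_sum (s := s.toNNReal) (t := t) (Real.toNNReal_le_iff_le_coe.2 hst.2),
      Real.coe_toNNReal s hst.1.le, Finset.mul_sum]
    · simp
    · intro i hi h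
      refine hs (Finset.mem_coe.2 (Finset.mem_image.2 ⟨i, hi, ?_⟩))
      rw [h, Real.coe_toNNReal s hst.1.le]
  have hc : Continuous fun s : ℝ => (lam₀ - lam) * Real.exp (-β * s) := by fun_prop
  have hi : ∀ i ∈ Finset.Icc 1 (N t ω), IntervalIntegrable
      (fun s => if (arrivalTime N i ω : ℝ) < s then
          α * Real.exp (-β * (s - arrivalTime N i ω)) else 0) volume 0 t := fun i _ =>
    intervalIntegrable_ite_lt (by fun_prop)
  have hi' : ∀ i ∈ Finset.Icc 1 (N t ω), IntervalIntegrable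
      (fun s : ℝ => if (arrivalTime N i ω : ℝ) < s then
          Real.exp (-β * (t - s)) else 0) volume 0 t := fun i _ =>
    intervalIntegrable_ite_lt (by fun_prop)
  have hsum : IntervalIntegrable (fun s => ∑ i ∈ Finset.Icc 1 (N t ω),
      if (arrivalTime N i ω : ℝ) < s then
          α * Real.exp (-β * (s - arrivalTime N i ω)) else 0) volume 0 t := by
    have := IntervalIntegrable.sum _ hi
    convert! this using 1
    ext s
    simp
  rw [h1, intervalIntegral.integral_add
      (intervalIntegrable_const.add (hc.intervalIntegrable _ _)) hsum,
    intervalIntegral.integral_add intervalIntegrable_const (hc.intervalIntegrable _ _),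
    intervalIntegral.integral_const, intervalIntegral.integral_const_mul,
    integral_exp_neg_mul hβ, intervalIntegral.integral_finsetSum hi, h2,
    intervalIntegral.integral_finsetSum hi', Finset.mul_sum]
  congr 1
  · simp; ring
  · refine Finset.sum_congr rfl fun i hi => ?_
    have h := NNReal.coe_le_coe.2 (hT i hi)
    rw [intervalIntegral_ite_lt _ (NNReal.coe_nonneg _) h,
      intervalIntegral_ite_lt _ (NNReal.coe_nonneg _) h, intervalIntegral.integral_const_mul,
      integral_exp_neg_sub_eq]

end Hawkes

/-! ### Integrability and mean of local martingales. -/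

namespace Hawkes
variable {Ω : Type*} [mΩ : MeasurableSpace Ω] {P : Measure Ω}

/-- The `Y n` are the localized stopped processes at time `t`. Each value of `Y n` is a value of `M`
at an earlier time, so pathwise bounds on `M` up to `t` pass to `Y n`, as Fatou and dominated
convergence require. -/
theorem IsLocalMartingale.exists_seq [IsFiniteMeasure P] {M : ℝ≥0 → Ω → ℝ} {𝓕 : Filtration ℝ≥0 mΩ}
    (hM : IsLocalMartingale M 𝓕 P) (h0 : ∀ ω, M 0 ω = 0) (t : ℝ≥0) :
    ∃ Y : ℕ → Ω → ℝ, (∀ n, Integrable (Y n) P) ∧ (∀ n, ∫ ω, Y n ω ∂P = 0) ∧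
      (∀ n ω, ∃ s ≤ t, Y n ω = M s ω) ∧ ∀ᵐ ω ∂P, ∀ᶠ n in atTop, Y n ω = M t ω := by
  obtain ⟨τ, hτ, hmart⟩ := hM
  refine ⟨fun n => stoppedProcess (fun i => {ω | ⊥ < τ n ω}.indicator (M i)) (τ n) t,
    fun n => (hmart n).integrable t, fun n => ?_, fun n ω => ?_, ?_⟩
  · have hz : stoppedProcess (fun i => {ω | ⊥ < τ n ω}.indicator (M i)) (τ n) 0 = 0 := by
      ext ω
      rw [stoppedProcess_eq_of_le (by simp)]
      simp [Set.indicator_apply, h0]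
    have h := (hmart n).setIntegral_eq (zero_le : 0 ≤ t) MeasurableSet.univ
    rw [hz] at h
    simpa using h.symm
  · by_cases hpos : ⊥ < τ n ω
    · refine ⟨(min (t : WithTop ℝ≥0) (τ n ω)).untopA, ?_, ?_⟩
      · rcases le_total (t : WithTop ℝ≥0) (τ n ω) with h | h
        · rw [min_eq_left h]; exact WithTop.untopA_le le_rfl
        · rw [min_eq_right h]
          exact WithTop.untopA_le h
      · exact Set.indicator_of_mem (s := {ω | ⊥ < τ n ω}) hpos _
    · exact ⟨0, zero_le, (Set.indicator_of_notMem (s := {ω | ⊥ < τ n ω}) hpos _).trans (h0 ω).symm⟩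
  · filter_upwards [hτ.tendsto_top] with ω hω
    filter_upwards [hω (Ioi_mem_nhds (WithTop.coe_lt_top t))] with n hn
    have hn : (t : WithTop ℝ≥0) < τ n ω := hn
    rw [stoppedProcess_eq_of_le hn.le, Set.indicator_of_mem]
    exact (bot_le : ⊥ ≤ (t : WithTop ℝ≥0)).trans_lt hn

/-- A local martingale started at `0` which is bounded below up to time `t` is integrable. -/
theorem IsLocalMartingale.integrable_of_bounded_below [IsProbabilityMeasure P] {M : ℝ≥0 → Ω → ℝ}
    {𝓕 : Filtration ℝ≥0 mΩ} (hM : IsLocalMartingale M 𝓕 P) (h0 : ∀ ω, M 0 ω = 0) {t : ℝ≥0} {C : ℝ}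
    (hC : ∀ s ≤ t, ∀ ω, 0 ≤ C + M s ω) : Integrable (M t) P := by
  obtain ⟨Y, hY, hY0, hYM, hlim⟩ := hM.exists_seq h0 t
  have hlim' : ∀ᵐ ω ∂P, Tendsto (fun n => Y n ω) atTop (𝓝 (M t ω)) := by
    filter_upwards [hlim] with ω hω
    exact tendsto_const_nhds.congr' (hω.mono fun n hn => hn.symm)
  have hmeas : AEStronglyMeasurable (M t) P :=
    aestronglyMeasurable_of_tendsto_ae atTop (fun n => (hY n).1) hlim'
  have hnn : ∀ n ω, 0 ≤ C + Y n ω := fun n ω => by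
    obtain ⟨s, hs, h⟩ := hYM n ω
    rw [h]; exact hC s hs ω
  have hint : ∀ n, ∫⁻ ω, ENNReal.ofReal (C + Y n ω) ∂P = ENNReal.ofReal C := fun n => by
    have h := ofReal_integral_eq_lintegral_ofReal (f := fun ω => C + Y n ω)
      ((integrable_const C).add (hY n)) (ae_of_all _ (hnn n))
    rw [← h, integral_add (integrable_const C) (hY n), hY0 n]
    simp
  have hfatou : ∫⁻ ω, ENNReal.ofReal (C + M t ω) ∂P ≤ ENNReal.ofReal C := by
    calc ∫⁻ ω, ENNReal.ofReal (C + M t ω) ∂P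
        = ∫⁻ ω, liminf (fun n => ENNReal.ofReal (C + Y n ω)) atTop ∂P := by
          refine lintegral_congr_ae ?_
          filter_upwards [hlim'] with ω hω
          exact ((ENNReal.tendsto_ofReal (hω.const_add C)).liminf_eq).symm
      _ ≤ liminf (fun n => ∫⁻ ω, ENNReal.ofReal (C + Y n ω) ∂P) atTop :=
          lintegral_liminf_le' fun n =>
            ((hY n).1.aemeasurable.const_add C).ennreal_ofReal
      _ = ENNReal.ofReal C := by simp [hint]
  have hsum : Integrable (fun ω => C + M t ω) P := by
    refine ⟨hmeas.const_add C, ?_⟩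
    rw [hasFiniteIntegral_iff_ofReal (ae_of_all _ (hC t le_rfl))]
    exact hfatou.trans_lt ENNReal.ofReal_lt_top
  convert! hsum.sub (integrable_const C) using 1
  ext ω
  simp

/-- A local martingale started at `0` which is dominated up to time `t` has mean `0` at `t`. -/
theorem IsLocalMartingale.integral_eq_zero [IsFiniteMeasure P] {M : ℝ≥0 → Ω → ℝ}
    {𝓕 : Filtration ℝ≥0 mΩ} (hM : IsLocalMartingale M 𝓕 P) (h0 : ∀ ω, M 0 ω = 0) {t : ℝ≥0}
    {G : Ω → ℝ} (hG : Integrable G P) (hMG : ∀ s ≤ t, ∀ ω, |M s ω| ≤ G ω) :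
    ∫ ω, M t ω ∂P = 0 := by
  obtain ⟨Y, hY, hY0, hYM, hlim⟩ := hM.exists_seq h0 t
  have h : Tendsto (fun n => ∫ ω, Y n ω ∂P) atTop (𝓝 (∫ ω, M t ω ∂P)) := by
    refine tendsto_integral_of_dominated_convergence G (fun n => (hY n).1) hG (fun n => ?_) ?_
    · refine ae_of_all _ fun ω => ?_
      obtain ⟨s, hs, h⟩ := hYM n ω
      rw [h]; exact hMG s hs ω
    · filter_upwards [hlim] with ω hω
      exact tendsto_const_nhds.congr' (hω.mono fun n hn => hn.symm)
  simp only [hY0] at h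
  exact (tendsto_nhds_unique tendsto_const_nhds h).symm

end Hawkes

/-! ### The Volterra equation with exponential kernel. -/

namespace Hawkes

/-- The solution of the linear Volterra equation with exponential kernel satisfied by the mean of
an exponentially decaying Hawkes process. -/
theorem volterra_exp_solution {lam c α β : ℝ} (hαβ : α ≠ β) {u : ℝ → ℝ} (hu0 : ∀ t ≤ 0, u t = 0)
    (hint : ∀ t, IntervalIntegrable u volume 0 t)
    (hu : ∀ t, 0 ≤ t → u t = lam * t + c * (1 - Real.exp (-β * t)) +
      α * ∫ s in (0 : ℝ)..t, Real.exp (-β * (t - s)) * u s) {t : ℝ} (ht : 0 ≤ t) :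
    u t = lam * β / (β - α) * t +
      (c * β - α * lam / (β - α)) / (β - α) * (1 - Real.exp (-(β - α) * t)) := by
  have hγ : β - α ≠ 0 := sub_ne_zero.2 hαβ.symm
  set v : ℝ → ℝ := fun t => ∫ s in (0 : ℝ)..t, Real.exp (β * s) * u s with hv
  have hint' : ∀ a b, IntervalIntegrable (fun s => Real.exp (β * s) * u s) volume a b :=
    fun a b => (((hint a).symm).trans (hint b)).continuousOn_mul
      (by fun_prop : Continuous fun s => Real.exp (β * s)).continuousOn
  have hvc : Continuous v := intervalIntegral.continuous_primitive hint' 0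
  have huv : ∀ t, 0 ≤ t → u t = lam * t + c * (1 - Real.exp (-β * t)) +
      α * (Real.exp (-β * t) * v t) := fun t ht => by
    rw [hu t ht, show v t = ∫ s in (0 : ℝ)..t, Real.exp (β * s) * u s from rfl]
    congr 2
    rw [← intervalIntegral.integral_const_mul]
    refine intervalIntegral.integral_congr (E := ℝ) fun s _ => ?_
    rw [← mul_assoc, ← Real.exp_add]
    congr 2
    ring
  -- Bootstrap: `v` is continuous as a primitive, so the equation makes `u` continuous, and hence
  -- `v` differentiable. Vanishing of `u` for `t ≤ 0` allows `max t 0` to replace `t`.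
  have huc : Continuous u := by
    have : u = fun t => lam * (max t 0) + c * (1 - Real.exp (-β * (max t 0))) +
        α * (Real.exp (-β * (max t 0)) * v (max t 0)) := by
      ext t
      rcases le_total t 0 with h | h
      · simp [h, hu0, hv]
      · rw [max_eq_left h, huv t h]
    rw [this]
    fun_prop
  have hvd : ∀ t, HasDerivAt v (Real.exp (β * t) * u t) t := fun t =>
    intervalIntegral.integral_hasDerivAt_right (hint' 0 t)
      (Continuous.stronglyMeasurableAtFilter (by fun_prop) _ _)
      (by fun_prop : Continuous fun s => Real.exp (β * s) * u s).continuousAt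
  set B : ℝ := (c * β - α * lam / (β - α)) / (β - α) with hB
  -- For `t ≥ 0` the equation reads `v' = α v` plus an explicit forcing term, with integrating
  -- factor `exp (-α t)`. The subtracted expression is a primitive of the resulting explicit
  -- right-hand side, so `g` is constant.
  set g : ℝ → ℝ := fun t => Real.exp (-α * t) * α * v t -
    (Real.exp ((β - α) * t) * (lam * β / (β - α) * t - lam * t + B - c) +
      c * Real.exp (-α * t)) with hg
  have hE : ∀ k t : ℝ, HasDerivAt (fun t => Real.exp (k * t)) (Real.exp (k * t) * k) t :=
    fun k t => by simpa using ((hasDerivAt_id t).const_mul k).exp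
  have hgd : ∀ t, 0 ≤ t → HasDerivAt g 0 t := fun t ht => by
    have hlin : HasDerivAt (fun t => lam * β / (β - α) * t - lam * t + B - c)
        (lam * β / (β - α) - lam) t := by
      simpa using (((((hasDerivAt_id t).const_mul (lam * β / (β - α))).sub
        ((hasDerivAt_id t).const_mul lam)).add_const B).sub_const c)
    have h := (((hE (-α) t).mul_const α).mul (hvd t)).sub
      (((hE (β - α) t).mul hlin).add ((hE (-α) t).const_mul c))
    refine h.congr_deriv ?_
    rw [huv t ht]
    have e1 : Real.exp (β * t) = Real.exp ((β - α) * t) * Real.exp (α * t) := by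
      rw [← Real.exp_add]; congr 1; ring
    have e2 : Real.exp (-α * t) = (Real.exp (α * t))⁻¹ := by
      rw [← Real.exp_neg]; congr 1; ring
    have e3 : Real.exp (-β * t) = (Real.exp (β * t))⁻¹ := by
      rw [← Real.exp_neg]; congr 1; ring
    rw [e3, e2, e1, hB]
    have := Real.exp_pos (α * t)
    have := Real.exp_pos ((β - α) * t)
    field_simp
    ring
  have hgt : g t = g 0 := by
    refine constant_of_has_deriv_right_zero (a := 0) (b := t) ?_ ?_ t ⟨ht, le_rfl⟩
    · exact fun x hx => (hgd x hx.1).continuousAt.continuousWithinAt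
    · exact fun x hx => (hgd x hx.1).hasDerivWithinAt
  have hg0 : g 0 = -B := by simp [hg, hv]
  rw [hg0] at hgt
  rw [huv t ht]
  have e0 : Real.exp (-β * t) * v t * α = Real.exp (-(β - α) * t) *
      (Real.exp (-α * t) * α * v t) := by
    rw [← mul_assoc, ← mul_assoc, ← Real.exp_add]
    ring_nf
  have e1 : Real.exp (-α * t) * α * v t = -B +
      (Real.exp ((β - α) * t) * (lam * β / (β - α) * t - lam * t + B - c) +
      c * Real.exp (-α * t)) := by
    rw [← hgt, hg]; ring
  have e2 : Real.exp (-(β - α) * t) * Real.exp ((β - α) * t) = 1 := by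
    rw [← Real.exp_add, ← add_mul, neg_add_cancel, zero_mul, Real.exp_zero]
  have e3 : Real.exp (-(β - α) * t) * Real.exp (-α * t) = Real.exp (-β * t) := by
    rw [← Real.exp_add]; congr 1; ring
  rw [mul_comm α, e0, e1]
  linear_combination (lam * β / (β - α) * t - lam * t + B - c) * e2 + c * e3

end Hawkes

/-! ### Path estimates and the mean of the Hawkes process. -/

namespace Hawkes

section Path
variable {Ω : Type*} [MeasurableSpace Ω] {N : ℝ≥0 → Ω → ℕ}

/-- Right-continuity makes `N` a pointwise limit of processes sampled on a countable time grid, each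
of which is jointly measurable. This is needed for Fubini. -/
theorem IsCountingProcess.measurable_uncurry (hN : IsCountingProcess N) :
    Measurable fun p : ℝ≥0 × Ω => N p.1 p.2 := by
  -- The first point of the grid of mesh `1 / (n + 1)` strictly to the right of `s`.
  let d : ℕ → ℝ≥0 → ℝ≥0 := fun n s => (⌊s * (n + 1 : ℕ)⌋₊ + 1 : ℕ) / (n + 1 : ℕ)
  have hd : ∀ s, Tendsto (fun n => d n s) atTop (𝓝[≥] s) := fun s => by
    have hlt : ∀ n, s < d n s := fun n => by
      rw [lt_div_iff₀ (by positivity)]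
      exact_mod_cast Nat.lt_floor_add_one (s * (n + 1 : ℕ))
    refine tendsto_nhdsWithin_iff.2 ⟨?_, Eventually.of_forall fun n => (hlt n).le⟩
    refine tendsto_of_tendsto_of_tendsto_of_le_of_le (tendsto_const_nhds (x := s))
      (h := fun n : ℕ => s + 1 / ((n : ℝ≥0) + 1)) ?_ (fun n => (hlt n).le) (fun n => ?_)
    · simpa using (tendsto_const_nhds (x := s)).add
        (tendsto_one_div_add_atTop_nhds_zero_nat (𝕜 := ℝ≥0))
    · have hn : (0 : ℝ≥0) < (n + 1 : ℕ) := by positivity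
      have := Nat.floor_le (zero_le : 0 ≤ s * (n + 1 : ℕ))
      dsimp only [d]
      rw [div_le_iff₀ hn, add_mul]
      push_cast at *
      rw [one_div, inv_mul_cancel₀ hn.ne']
      gcongr
  refine measurable_of_tendsto_metrizable
    (f := fun n (p : ℝ≥0 × Ω) => N (d n p.1) p.2) (fun n => ?_) ?_
  · have h : Measurable fun q : ℕ × Ω => N ((q.1 + 1 : ℕ) / (n + 1 : ℕ)) q.2 :=
      measurable_from_prod_countable_right fun k => hN.measurable ((k + 1 : ℕ) / (n + 1 : ℕ))
    exact h.comp (((Nat.measurable_floor.comp (measurable_fst.mul_const _))).prodMk measurable_snd)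
  · refine tendsto_pi_nhds.2 fun p => ?_
    exact (hN.right_cts p.2 p.1).tendsto.comp (hd p.1)

theorem IsCountingProcess.monotone_toNNReal (hN : IsCountingProcess N) (ω : Ω) :
    Monotone fun s : ℝ => (N s.toNNReal ω : ℝ) := fun _ _ h =>
  Nat.cast_le.2 (hN.mono ω (Real.toNNReal_le_toNNReal h))

theorem integral_exp_neg_mul_sub {β : ℝ} (hβ : β ≠ 0) (t : ℝ) :
    ∫ s in (0 : ℝ)..t, Real.exp (-β * (t - s)) = (1 - Real.exp (-β * t)) / β := by
  rw [← integral_exp_neg_sub_eq, ← integral_exp_neg_mul hβ]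
  simp

theorem IsCountingProcess.convolution_mem_Icc (hN : IsCountingProcess N) {β : ℝ} (hβ : 0 < β)
    (t : ℝ≥0) (ω : Ω) :
    ∫ s in (0 : ℝ)..t, Real.exp (-β * (t - s)) * N s.toNNReal ω ∈
      Set.Icc 0 ((N t ω : ℝ) / β) := by
  have hE : Continuous fun s : ℝ => Real.exp (-β * (t - s)) := by fun_prop
  constructor
  · exact intervalIntegral.integral_nonneg t.coe_nonneg fun s _ => by positivity
  · calc ∫ s in (0 : ℝ)..t, Real.exp (-β * (t - s)) * N s.toNNReal ω
        ≤ ∫ s in (0 : ℝ)..t, Real.exp (-β * (t - s)) * N t ω := by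
          refine intervalIntegral.integral_mono_on t.coe_nonneg ?_ ?_ fun s hs => ?_
          · exact (hN.monotone_toNNReal ω).intervalIntegrable.continuousOn_mul hE.continuousOn
          · exact (hE.intervalIntegrable _ _).mul_const _
          · gcongr
            exact hN.mono ω (Real.toNNReal_le_iff_le_coe.2 hs.2)
      _ = (1 - Real.exp (-β * t)) * (N t ω / β) := by
          rw [intervalIntegral.integral_mul_const, integral_exp_neg_mul_sub hβ.ne']
          ring
      _ ≤ 1 * (N t ω / β) := by
          gcongr
          simpa using (Real.exp_pos (-β * t)).le
      _ = N t ω / β := one_mul _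

/-- The coefficient `α / β` of `N s` is what matters: when it is below `1`, the compensator can be
absorbed into `N`. The lower bound may be negative because `lam₀ < lam` is allowed. -/
theorem IsCountingProcess.compensator_expIntensity_bounds (hN : IsCountingProcess N) {lam₀ lam α β : ℝ}
    (hlam : 0 ≤ lam) (hα : 0 ≤ α) (hβ : 0 < β) {s t : ℝ≥0} (hst : s ≤ t) (ω : Ω) :
    compensator (expIntensity lam₀ lam α β N) s ω ≤
        lam * t + |(lam₀ - lam) / β| + α / β * N s ω ∧
      -|(lam₀ - lam) / β| ≤ compensator (expIntensity lam₀ lam α β N) s ω := by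
  rw [hN.compensator_expIntensity lam₀ lam α hβ.ne']
  obtain ⟨h1, h2⟩ := hN.convolution_mem_Icc hβ s ω
  have hs : lam * s ≤ lam * t := by gcongr
  have hs0 : 0 ≤ lam * s := by positivity
  have he : |(lam₀ - lam) / β * (1 - Real.exp (-β * s))| ≤ |(lam₀ - lam) / β| := by
    rw [abs_mul]
    refine mul_le_of_le_one_right (abs_nonneg _) (abs_le.2 ⟨?_, ?_⟩)
    · have : Real.exp (-β * s) ≤ 1 := Real.exp_le_one_iff.2 (by
        have : 0 ≤ β * s := by positivity
        linarith)
      linarith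
    · linarith [Real.exp_pos (-β * s)]
  have h3 := mul_le_mul_of_nonneg_left h2 hα
  have h4 := mul_nonneg hα h1
  have h5 : α * (N s ω / β) = α / β * N s ω := by ring
  have := abs_le.1 he
  constructor <;> linarith

end Path

theorem compensator_zero {Ω : Type*} (ℓ : ℝ≥0 → Ω → ℝ) (ω : Ω) : compensator ℓ 0 ω = 0 := by
  simp [compensator]

variable {Ω : Type*} [MeasurableSpace Ω] {P : Measure Ω} {N : ℝ≥0 → Ω → ℕ} {lam₀ lam α β : ℝ}

theorem IsExpHawkesProcess.integrable [IsProbabilityMeasure P]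
    (hN : IsExpHawkesProcess lam₀ lam α β N P) (hlam : 0 ≤ lam) (hα : 0 ≤ α) (hαβ : α < β)
    (t : ℝ≥0) : Integrable (fun ω => (N t ω : ℝ)) P := by
  have hβ : 0 < β := hα.trans_lt hαβ
  have hr : 0 < 1 - α / β := sub_pos.2 ((div_lt_one hβ).2 hαβ)
  set C := lam * t + |(lam₀ - lam) / β| with hC
  have hb : ∀ s ≤ t, ∀ ω, (1 - α / β) * N s ω ≤
      C + (N s ω - compensator (expIntensity lam₀ lam α β N) s ω) := fun s hs ω => by
    have := (hN.counting.compensator_expIntensity_bounds (lam₀ := lam₀) hlam hα hβ hs ω).1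
    rw [hC]; linarith
  have hM := hN.intensity.integrable_of_bounded_below
    (fun ω => by simp [hN.counting.zero, compensator_zero]) (t := t) (C := C)
    fun s hs ω => le_trans (by positivity) (hb s hs ω)
  refine (((integrable_const C).add hM).const_mul (1 - α / β)⁻¹).mono'
    ((measurable_from_nat (f := fun n : ℕ => (n : ℝ))).comp
      (hN.counting.measurable t)).aestronglyMeasurable (ae_of_all _ fun ω => ?_)
  rw [Real.norm_of_nonneg (Nat.cast_nonneg _), le_inv_mul_iff₀ hr]
  exact hb t le_rfl ω

theorem IsExpHawkesProcess.integral_eq_integral_compensator [IsProbabilityMeasure P]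
    (hN : IsExpHawkesProcess lam₀ lam α β N P) (hlam : 0 ≤ lam) (hα : 0 ≤ α) (hαβ : α < β)
    (t : ℝ≥0) : ∫ ω, ((N t ω : ℝ) - compensator (expIntensity lam₀ lam α β N) t ω) ∂P = 0 := by
  have hβ : 0 < β := hα.trans_lt hαβ
  have hr : α / β < 1 := (div_lt_one hβ).2 hαβ
  refine hN.intensity.integral_eq_zero (fun ω => by simp [hN.counting.zero, compensator_zero])
    (G := fun ω => (lam * t + |(lam₀ - lam) / β|) + N t ω)
    ((integrable_const _).add (hN.integrable hlam hα hαβ t)) fun s hs ω => ?_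
  obtain ⟨h1, h2⟩ := hN.counting.compensator_expIntensity_bounds (lam₀ := lam₀) hlam hα hβ hs ω
  have h3 : (N s ω : ℝ) ≤ N t ω := Nat.cast_le.2 (hN.counting.mono ω hs)
  have h4 : 0 ≤ lam * t := by positivity
  have h5 : (0 : ℝ) ≤ N s ω := Nat.cast_nonneg _
  have h6 := mul_le_mul_of_nonneg_right hr.le h5
  rw [abs_le]
  constructor <;> linarith

/-- The Volterra equation for the mean of an exponentially decaying Hawkes process. -/
theorem IsExpHawkesProcess.integral_eq_volterra [IsProbabilityMeasure P]
    (hN : IsExpHawkesProcess lam₀ lam α β N P) (hlam : 0 ≤ lam) (hα : 0 ≤ α) (hαβ : α < β)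
    (t : ℝ≥0) : ∫ ω, (N t ω : ℝ) ∂P =
      lam * t + (lam₀ - lam) / β * (1 - Real.exp (-β * t)) +
        α * ∫ s in (0 : ℝ)..t, Real.exp (-β * (t - s)) * ∫ ω, (N s.toNNReal ω : ℝ) ∂P := by
  have hβ : 0 < β := hα.trans_lt hαβ
  have hmeas : Measurable fun p : ℝ × Ω => Real.exp (-β * (t - p.1)) * N p.1.toNNReal p.2 := by
    refine Measurable.mul (by fun_prop) ((measurable_from_nat (f := fun n : ℕ => (n : ℝ))).comp ?_)
    exact hN.counting.measurable_uncurry.comp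
      ((measurable_real_toNNReal.comp measurable_fst).prodMk measurable_snd)
  -- By monotonicity of paths, `N t` dominates the integrand on the whole interval.
  have hprod : Integrable (Function.uncurry fun (s : ℝ) ω =>
      Real.exp (-β * (t - s)) * N s.toNNReal ω) ((volume.restrict (Set.Ioc 0 (t : ℝ))).prod P) := by
    refine ((hN.integrable hlam hα hαβ t).comp_snd (volume.restrict (Set.Ioc 0 (t : ℝ)))).mono'
      hmeas.aestronglyMeasurable ?_
    have hae : ∀ᵐ s ∂(volume.restrict (Set.Ioc 0 (t : ℝ))), s ∈ Set.Ioc 0 (t : ℝ) :=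
      ae_restrict_mem measurableSet_Ioc
    filter_upwards [Measure.quasiMeasurePreserving_fst.ae hae] with p hp
    have h1 : Real.exp (-β * (t - p.1)) ≤ 1 := Real.exp_le_one_iff.2 (by
      have := mul_nonneg hβ.le (sub_nonneg.2 hp.2)
      linarith)
    have h2 : (N p.1.toNNReal p.2 : ℝ) ≤ N t p.2 :=
      Nat.cast_le.2 (hN.counting.mono p.2 (Real.toNNReal_le_iff_le_coe.2 hp.2))
    rw [Function.uncurry, Real.norm_of_nonneg (by positivity)]
    calc _ ≤ 1 * (N t p.2 : ℝ) := by gcongr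
      _ = _ := one_mul _
  have hconv : Integrable (fun ω => ∫ s in (0 : ℝ)..t,
      Real.exp (-β * (t - s)) * N s.toNNReal ω) P := by
    simp only [intervalIntegral.integral_of_le t.coe_nonneg]
    exact hprod.integral_prod_right
  have hswap : ∫ ω, (∫ s in (0 : ℝ)..t, Real.exp (-β * (t - s)) * N s.toNNReal ω) ∂P =
      ∫ s in (0 : ℝ)..t, Real.exp (-β * (t - s)) * ∫ ω, (N s.toNNReal ω : ℝ) ∂P := by
    simp only [intervalIntegral.integral_of_le t.coe_nonneg, ← integral_const_mul]
    exact (integral_integral_swap hprod).symm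
  have h := hN.integral_eq_integral_compensator hlam hα hαβ t
  simp only [hN.counting.compensator_expIntensity lam₀ lam α hβ.ne'] at h
  set d := lam * t + (lam₀ - lam) / β * (1 - Real.exp (-β * t))
  have hd : Integrable (fun ω => d + α * ∫ s in (0 : ℝ)..t,
      Real.exp (-β * (t - s)) * N s.toNNReal ω) P := (integrable_const d).add (hconv.const_mul α)
  rw [integral_sub (hN.integrable hlam hα hαβ t) hd, integral_add (integrable_const _)
    (hconv.const_mul α), integral_const_mul, hswap, sub_eq_zero] at h
  simpa using h

/-- The mean of an exponentially decaying Hawkes process. -/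
theorem IsExpHawkesProcess.integral_eq [IsProbabilityMeasure P]
    (hN : IsExpHawkesProcess lam₀ lam α β N P) (hlam : 0 ≤ lam) (hα : 0 ≤ α) (hαβ : α < β)
    (t : ℝ≥0) : ∫ ω, (N t ω : ℝ) ∂P = lam * β / (β - α) * t +
      ((lam₀ - lam) / β * β - α * lam / (β - α)) / (β - α) *
        (1 - Real.exp (-(β - α) * t)) := by
  have hmono : Monotone fun s : ℝ => ∫ ω, (N s.toNNReal ω : ℝ) ∂P := fun a b hab =>
    integral_mono (hN.integrable hlam hα hαβ _) (hN.integrable hlam hα hαβ _)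
      fun ω => hN.counting.monotone_toNNReal ω hab
  have h := volterra_exp_solution (lam := lam) (c := (lam₀ - lam) / β) (β := β) hαβ.ne
    (u := fun s => ∫ ω, (N s.toNNReal ω : ℝ) ∂P)
    (fun s hs => by simp [Real.toNNReal_of_nonpos hs, hN.counting.zero])
    (fun _ => hmono.intervalIntegrable)
    (fun s hs => by
      have h := hN.integral_eq_volterra hlam hα hαβ s.toNNReal
      rwa [Real.coe_toNNReal s hs] at h) t.coe_nonneg
  simpa only [Real.toNNReal_coe] using h

end Hawkes

theorem proposition1 {Ω : Type*} [MeasurableSpace Ω] (P : Measure Ω) [IsProbabilityMeasure P]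
    (lam₀ lam α β : ℝ) (hlam₀ : 0 < lam₀) (hlam : 0 < lam) (hα : 0 < α) (hαβ : α < β)
    (N : ℝ≥0 → Ω → ℕ) (hN : Hawkes.IsExpHawkesProcess lam₀ lam α β N P) (τ : ℝ≥0) :
    (∀ t : ℝ≥0, Integrable (fun ω => (N (t + τ) ω : ℝ) - (N t ω : ℝ)) P) ∧
      Tendsto (fun t : ℝ≥0 => ∫ ω, ((N (t + τ) ω : ℝ) - (N t ω : ℝ)) ∂P) atTop
        (𝓝 (lam * β / (β - α) * (τ : ℝ))) := by
  have hint := hN.integrable hlam.le hα.le hαβ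
  refine ⟨fun t => (hint (t + τ)).sub (hint t), ?_⟩
  set B := ((lam₀ - lam) / β * β - α * lam / (β - α)) / (β - α) with hB
  have hexp : Tendsto (fun t : ℝ≥0 => Real.exp (-(β - α) * t)) atTop (𝓝 0) :=
    Real.tendsto_exp_atBot.comp
      ((tendsto_id.const_mul_atTop_of_neg (by linarith : -(β - α) < 0)).comp
        (NNReal.tendsto_coe_atTop.2 tendsto_id))
  -- The function on the left is the exact mean increment for every `t`, obtained by subtracting two
  -- values of the closed formula.
  have hlim : Tendsto (fun t : ℝ≥0 => lam * β / (β - α) * (τ : ℝ) +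
      B * (1 - Real.exp (-(β - α) * τ)) * Real.exp (-(β - α) * t)) atTop
      (𝓝 (lam * β / (β - α) * (τ : ℝ) + B * (1 - Real.exp (-(β - α) * τ)) * 0)) :=
    (hexp.const_mul _).const_add _
  rw [mul_zero, add_zero] at hlim
  refine hlim.congr fun t => ?_
  rw [integral_sub (hint _) (hint _), hN.integral_eq hlam.le hα.le hαβ,
    hN.integral_eq hlam.le hα.le hαβ, ← hB, NNReal.coe_add, mul_add (-(β - α)), Real.exp_add]
  ring
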